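/- Let $n\ge 2$ be an integer, let $w=(w_1,\dots,w_n)\in\mathbb{R}^n$ have all components nonzero, and let $z\in\mathbb{R}$. Write $\|w\|_2=(\sum_{i=1}^n w_i^2)^{1/2}$, let $\mathrm{vol}_{n-1}$ denote $(n-1)$-dimensional Euclidean volume, let $r_+^{k}:=(\max\{r,0\})^{k}$ for $r\in\mathbb{R}$, $k\ge 1$, and for $K\subseteq\{1,\dots,n\}$ let $\mathbf 1_K\in\{0,1\}^n$ denote the characteristic vector of $K$. Then $$\mathrm{vol}_{n-1}\bigl(\{x\in[0,1]^n : w\cdot x=z\}\bigr)=\frac{\|w\|_2}{(n-1)!\,\prod_{i=1}^n w_i}\sum_{K\subseteq\{1,\dots,n\}}(-1)^{|K|}\,(z-w\cdot\mathbf 1_K)_+^{\,n-1}.$$ In particular, for the central section of the centered cube, $$\mathrm{vol}_{n-1}\bigl(\{x\in[-\tfrac12,\tfrac12]^n : w\cdot x=0\}\bigr)=\frac{\|w\|_2}{2^{n-1}(n-1)!\,\prod_{i=1}^n w_i}\sum_{s\in\{-1,1\}^n}\epsilon_s\,(w\cdot s)_+^{\,n-1},\qquad \epsilon_s:=\prod_{i=1}^n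 s_i.$$ -/

import Mathlib

open MeasureTheory

namespace CubeSection

/-- The unit cube `[0,1]ⁿ` in Euclidean space. -/
def unitCube (n : ℕ) : Set (EuclideanSpace ℝ (Fin n)) :=
  {x | ∀ i, x i ∈ Set.Icc (0 : ℝ) 1}

/-- The centered unit cube `[-1/2,1/2]ⁿ` in Euclidean space. -/
def centeredCube (n : ℕ) : Set (EuclideanSpace ℝ (Fin n)) :=
  {x | ∀ i, x i ∈ Set.Icc (-(1 / 2) : ℝ) (1 / 2)}

/-- The hyperplane `{x : w · x = z}` with normal vector `w`. -/
def hyperplane {n : ℕ} (w : EuclideanSpace ℝ (Fin n)) (z : ℝ) :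
    Set (EuclideanSpace ℝ (Fin n)) :=
  {x | w.ofLp ⬝ᵥ x.ofLp = z}

/-- The characteristic vector `1_K` of a set `K` of indices. -/
def charVec {n : ℕ} (K : Finset (Fin n)) : Fin n → ℝ :=
  fun i => if i ∈ K then 1 else 0

/-- The set `{-1,1}ⁿ` of sign vectors. -/
noncomputable def signVectors (n : ℕ) : Finset (Fin n → ℝ) :=
  Fintype.piFinset fun _ => {-1, 1}

/-- The truncated power `r₊ᵏ = (max {r, 0})ᵏ`. -/
noncomputable def truncPow (r : ℝ) (k : ℕ) : ℝ :=
  (max r 0) ^ k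

end CubeSection

namespace CubeSection

/-! Solving `w · x = z` for the first coordinate makes the section a graph over the other m = n - 1
coordinates y, with constant area factor `‖w‖ / |w 0|`. Its base is the set of y in the m-cube with
z - w'·y between 0 and `w 0`, where w' is the tail of w, so its volume is the cube integral of a
segment indicator evaluated at z - w'·y.

By Fubini, integrating out a coordinate with weight w_i turns g(r) into (G(r) - G(r - w_i)) / w_i,
with G a primitive of g (`IsPrimitiveSeq.integral_cube`). The resulting differences give the signed
sum over subsets. The segment indicator is, off its endpoints, a signed difference of two step
functions, whose m-fold primitives are truncated powers over m!.

The central section follows by translating the cube and rescaling. -/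

/-- A sequence of locally bounded functions, each of which is a continuous primitive of the
previous one off a fixed countable set. -/
structure IsPrimitiveSeq (G : ℕ → ℝ → ℝ) (s : Set ℝ) : Prop where
  countable : s.Countable
  measurable_zero : Measurable (G 0)
  bounded_zero : ∃ C, ∀ r, ‖G 0 r‖ ≤ C
  continuous_succ : ∀ k, Continuous (G (k + 1))
  hasDerivAt : ∀ k, ∀ r ∉ s, HasDerivAt (G (k + 1)) (G k r) r

namespace IsPrimitiveSeq

variable {G : ℕ → ℝ → ℝ} {s : Set ℝ}

theorem measurable (h : IsPrimitiveSeq G s) (k : ℕ) : Measurable (G k) := by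
  cases k with
  | zero => exact h.measurable_zero
  | succ k => exact (h.continuous_succ k).measurable

theorem exists_bound (h : IsPrimitiveSeq G s) (k : ℕ) (R : ℝ) :
    ∃ C, ∀ r, |r| ≤ R → ‖G k r‖ ≤ C := by
  cases k with
  | zero =>
    obtain ⟨C, hC⟩ := h.bounded_zero
    exact ⟨C, fun r _ => hC r⟩
  | succ k =>
    obtain ⟨C, hC⟩ := (isCompact_Icc (a := -R) (b := R)).exists_bound_of_continuousOn
      (h.continuous_succ k).continuousOn
    exact ⟨C, fun r hr => hC r (abs_le.mp hr)⟩

theorem intervalIntegrable (h : IsPrimitiveSeq G s) (k : ℕ) (a b : ℝ) :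
    IntervalIntegrable (G k) volume a b := by
  obtain ⟨C, hC⟩ := h.exists_bound k (max |a| |b|)
  rw [intervalIntegrable_iff]
  refine Measure.integrableOn_of_bounded (M := C) (by simp)
    (h.measurable k).aestronglyMeasurable ?_
  refine (ae_restrict_mem measurableSet_uIoc).mono fun r hr => hC r ?_
  have hr' := Set.uIoc_subset_uIcc hr
  rw [Set.mem_uIcc] at hr'
  rcases hr' with hr' | hr'
  · exact abs_le_max_abs_abs hr'.1 hr'.2
  · rw [max_comm]
    exact abs_le_max_abs_abs hr'.1 hr'.2

theorem integral_Icc_comp_sub_mul (h : IsPrimitiveSeq G s) (k : ℕ) {w : ℝ} (hw : w ≠ 0) (a : ℝ) :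
    ∫ t in Set.Icc (0 : ℝ) 1, G k (a - w * t) = w⁻¹ * (G (k + 1) a - G (k + 1) (a - w)) := by
  rw [integral_Icc_eq_integral_Ioc, ← intervalIntegral.integral_of_le zero_le_one,
    intervalIntegral.integral_comp_sub_mul (G k) hw,
    integral_eq_of_hasDerivAt_off_countable _ _ h.countable (h.continuous_succ k).continuousOn
      (fun x hx => h.hasDerivAt k x hx.2) (h.intervalIntegrable k _ _)]
  simp

end IsPrimitiveSeq

/-! ### Iterated integration over the cube -/

/-- Lebesgue measure on the unit cube in `Fin m → ℝ`. -/
noncomputable abbrev cubeMeasure (m : ℕ) : Measure (Fin m → ℝ) :=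
  Measure.pi fun _ => volume.restrict (Set.Icc (0 : ℝ) 1)

theorem ae_cubeMeasure_mem (m : ℕ) :
    ∀ᵐ y ∂cubeMeasure m, ∀ i, y i ∈ Set.Icc (0 : ℝ) 1 := by
  rw [cubeMeasure, ← Measure.restrict_pi_pi]
  refine (ae_restrict_mem (MeasurableSet.univ_pi fun _ => measurableSet_Icc)).mono ?_
  intro y hy i
  exact hy i (Set.mem_univ i)

theorem abs_dotProduct_le_of_mem {m : ℕ} (w : Fin m → ℝ) {y : Fin m → ℝ}
    (hy : ∀ i, y i ∈ Set.Icc (0 : ℝ) 1) : |w ⬝ᵥ y| ≤ ∑ i, |w i| := by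
  refine (Finset.abs_sum_le_sum_abs _ _).trans (Finset.sum_le_sum fun i _ => ?_)
  rw [abs_mul, abs_of_nonneg (hy i).1]
  exact mul_le_of_le_one_right (abs_nonneg _) (hy i).2

@[fun_prop]
theorem measurable_dotProduct_right {m : ℕ} (w : Fin m → ℝ) :
    Measurable fun y : Fin m → ℝ => w ⬝ᵥ y := by
  unfold dotProduct
  fun_prop

theorem IsPrimitiveSeq.integrable {G : ℕ → ℝ → ℝ} {s : Set ℝ} (h : IsPrimitiveSeq G s) (k : ℕ)
    {m : ℕ} (w : Fin m → ℝ) (z : ℝ) :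
    Integrable (fun y => G k (z - w ⬝ᵥ y)) (cubeMeasure m) := by
  obtain ⟨C, hC⟩ := h.exists_bound k (|z| + ∑ i, |w i|)
  refine Integrable.of_bound
    ((h.measurable k).comp (by fun_prop)).aestronglyMeasurable C ?_
  refine (ae_cubeMeasure_mem m).mono fun y hy => hC _ ?_
  exact (abs_sub _ _).trans (by gcongr; exact abs_dotProduct_le_of_mem w hy)

theorem charVec_insert_zero_map {m : ℕ} (K : Finset (Fin m)) :
    charVec (insert 0 (K.map (Fin.succEmb m))) = Fin.cons 1 (charVec K) := by
  ext i
  refine Fin.cases ?_ (fun j => ?_) i <;> simp [charVec]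

theorem charVec_map {m : ℕ} (K : Finset (Fin m)) :
    charVec (K.map (Fin.succEmb m)) = Fin.cons 0 (charVec K) := by
  ext i
  refine Fin.cases ?_ (fun j => ?_) i <;> simp [charVec]

theorem sum_finset_fin_succ {m : ℕ} (f : Finset (Fin (m + 1)) → ℝ) :
    ∑ K, f K = ∑ K : Finset (Fin m),
      (f (K.map (Fin.succEmb m)) + f (insert 0 (K.map (Fin.succEmb m)))) := by
  have huniv : (Finset.univ : Finset (Fin (m + 1))) =
      insert 0 (Finset.univ.image Fin.succ) := by
    ext i
    refine Fin.cases ?_ (fun j => ?_) i <;> simp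
  rw [← Finset.powerset_univ, huniv, Finset.sum_powerset_insert (by simp),
    Finset.powerset_image, ← Finset.sum_add_distrib, Finset.powerset_univ,
    Finset.sum_image ((Finset.image_injective (Fin.succ_injective m)).injOn)]
  simp [Finset.map_eq_image]

theorem dotProduct_fin_succ {m : ℕ} (w y : Fin (m + 1) → ℝ) :
    w ⬝ᵥ y = w 0 * y 0 + Fin.tail w ⬝ᵥ Fin.tail y := by
  simp [dotProduct, Fin.sum_univ_succ, Fin.tail]

/-- Induction on dimension, with `k` and `z` free: integrating out coordinate 0 raises `k` by one
and leaves two terms, at `z` and at `z - w 0`, which account for the subsets without and with 0. -/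
theorem IsPrimitiveSeq.integral_cube {G : ℕ → ℝ → ℝ} {s : Set ℝ} (h : IsPrimitiveSeq G s) :
    ∀ {m : ℕ} (k : ℕ) {w : Fin m → ℝ} (_ : ∀ i, w i ≠ 0) (z : ℝ),
    ∫ y, G k (z - w ⬝ᵥ y) ∂cubeMeasure m = (∏ i, w i)⁻¹ *
      ∑ K : Finset (Fin m), (-1 : ℝ) ^ K.card * G (k + m) (z - w ⬝ᵥ charVec K) := by
  intro m
  induction m with
  | zero =>
    intro k w _ z
    have huniv : (cubeMeasure 0).real Set.univ = 1 := by
      rw [← Set.pi_univ Set.univ, Measure.real, Measure.pi_pi]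
      simp
    simp only [dotProduct, Finset.univ_eq_empty, Finset.sum_empty, sub_zero, integral_const, huniv,
      one_smul, Finset.prod_empty, inv_one, one_mul, add_zero]
    rw [Fintype.sum_unique, show (default : Finset (Fin 0)) = ∅ from rfl]
    simp
  | succ m ih =>
    intro k w hw z
    have hmp := measurePreserving_piFinSuccAbove
      (fun _ : Fin (m + 1) => (volume.restrict (Set.Icc (0 : ℝ) 1))) 0
    let F : ℝ × (Fin m → ℝ) → ℝ := fun p => G k (z - (w 0 * p.1 + Fin.tail w ⬝ᵥ p.2))
    have hfun : (fun y => G k (z - w ⬝ᵥ y)) =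
        F ∘ MeasurableEquiv.piFinSuccAbove (fun _ => ℝ) 0 := by
      ext y
      rw [dotProduct_fin_succ]
      rfl
    have hint := h.integrable k w z
    rw [hfun, hmp.integrable_comp_emb (MeasurableEquiv.measurableEmbedding _)] at hint
    rw [hfun]
    refine (hmp.integral_comp (MeasurableEquiv.measurableEmbedding _) F).trans ?_
    rw [integral_prod_symm _ hint]
    have hw' : ∀ i, Fin.tail w i ≠ 0 := fun i => hw i.succ
    have hinner : ∀ y : Fin m → ℝ,
        ∫ t in Set.Icc (0 : ℝ) 1, G k (z - (w 0 * t + Fin.tail w ⬝ᵥ y)) =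
        (w 0)⁻¹ * (G (k + 1) (z - Fin.tail w ⬝ᵥ y) -
          G (k + 1) (z - w 0 - Fin.tail w ⬝ᵥ y)) := by
      intro y
      have := h.integral_Icc_comp_sub_mul k (hw 0) (z - Fin.tail w ⬝ᵥ y)
      rw [sub_right_comm] at this
      rw [← this]
      congr with t
      congr 1
      ring
    refine (integral_congr_ae (.of_forall hinner)).trans ?_
    rw [integral_const_mul, integral_sub (h.integrable _ _ _) (h.integrable _ _ _),
      ih _ hw', ih _ hw', ← mul_sub, ← Finset.sum_sub_distrib, sum_finset_fin_succ,
      Fin.prod_univ_succ, mul_inv, mul_assoc]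
    congr 2
    refine Finset.sum_congr rfl fun K _ => ?_
    rw [Finset.card_insert_of_notMem (by simp [Fin.succ_ne_zero]), Finset.card_map,
      charVec_map, charVec_insert_zero_map, dotProduct_fin_succ, dotProduct_fin_succ]
    simp only [Fin.cons_zero, Fin.tail_cons, mul_zero, mul_one, zero_add, ← sub_sub, pow_succ,
      add_assoc, add_comm 1 m]
    ring

/-! ### Truncated powers as primitives of a segment indicator -/

theorem continuous_truncPow (k : ℕ) : Continuous fun r => truncPow r k := by
  unfold truncPow
  fun_prop

theorem hasDerivAt_truncPow_succ (k : ℕ) {r : ℝ} (hr : r ≠ 0) :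
    HasDerivAt (fun r => truncPow r (k + 1)) ((k + 1) * if 0 < r then r ^ k else 0) r := by
  rcases hr.lt_or_gt with hr | hr
  · rw [if_neg hr.not_gt, mul_zero]
    refine (hasDerivAt_const r (0 : ℝ)).congr_of_eventuallyEq ?_
    filter_upwards [Iio_mem_nhds hr] with x hx
    simp [truncPow, max_eq_right (le_of_lt (Set.mem_Iio.mp hx))]
  · rw [if_pos hr]
    have h := hasDerivAt_pow (k + 1) r
    simp only [Nat.cast_add, Nat.cast_one, Nat.add_sub_cancel] at h
    refine h.congr_of_eventuallyEq ?_
    filter_upwards [Ioi_mem_nhds hr] with x hx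
    simp [truncPow, max_eq_left (le_of_lt (Set.mem_Ioi.mp hx))]

theorem truncPow_succ_eq_ite (r : ℝ) (k : ℕ) :
    truncPow r (k + 1) = if 0 < r then r ^ (k + 1) else 0 := by
  unfold truncPow
  split_ifs with h
  · rw [max_eq_left h.le]
  · rw [max_eq_right (not_lt.mp h), zero_pow k.succ_ne_zero]

/-- The indicator function of the segment between `0` and `a`, followed by its iterated
primitives. -/
noncomputable def segmentPrimitive (a : ℝ) : ℕ → ℝ → ℝ
  | 0 => Set.indicator {r | r / a ∈ Set.Icc (0 : ℝ) 1} 1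
  | k + 1 => fun r => |a| / a / (k + 1).factorial * (truncPow r (k + 1) - truncPow (r - a) (k + 1))

/-- The sign `|a| / a` corrects the orientation when `a < 0`. The endpoints are excluded because the
segment is closed while the steps are strict. -/
theorem segmentPrimitive_zero_eq {a r : ℝ} (ha : a ≠ 0) (hr : r ≠ 0) (hra : r - a ≠ 0) :
    segmentPrimitive a 0 r =
      |a| / a * ((if 0 < r then 1 else 0) - if 0 < r - a then 1 else 0) := by
  have hmem : r / a ∈ Set.Icc (0 : ℝ) 1 ↔ (0 < a ∧ 0 < r ∧ r - a < 0) ∨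
      (a < 0 ∧ r < 0 ∧ 0 < r - a) := by
    rcases ha.lt_or_gt with h | h
    · rw [Set.mem_Icc, div_le_one_of_neg h, le_div_iff_of_neg h, zero_mul]
      grind
    · rw [Set.mem_Icc, div_le_one h, le_div_iff₀ h, zero_mul]
      grind
  simp only [segmentPrimitive, Set.indicator_apply, Set.mem_ofPred_eq, hmem, Pi.one_apply]
  rcases ha.lt_or_gt with h | h
  · rw [abs_of_neg h, neg_div, div_self ha]
    grind
  · rw [abs_of_pos h, div_self ha]
    grind

theorem isPrimitiveSeq_segmentPrimitive {a : ℝ} (ha : a ≠ 0) :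
    IsPrimitiveSeq (segmentPrimitive a) {0, a} where
  countable := (Set.toFinite _).countable
  measurable_zero := measurable_one.indicator (measurableSet_Icc.preimage (by fun_prop))
  bounded_zero := by
    refine ⟨1, fun r => ?_⟩
    exact (norm_indicator_le_norm_self _ _).trans (by simp)
  continuous_succ k := by
    simp only [segmentPrimitive]
    have := continuous_truncPow (k + 1)
    exact continuous_const.mul (this.sub (this.comp (by fun_prop : Continuous fun r => r - a)))
  hasDerivAt k r hr := by
    simp only [Set.mem_insert_iff, Set.mem_singleton_iff, not_or] at hr
    have hra : r - a ≠ 0 := sub_ne_zero.mpr hr.2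
    have h2 := (hasDerivAt_truncPow_succ k hra).comp_sub_const r a
    convert! ((hasDerivAt_truncPow_succ k hr.1).sub h2).const_mul
      (|a| / a / (k + 1).factorial) using 1
    have hk : ((k : ℝ) + 1) ≠ 0 := by positivity
    have hf : (k.factorial : ℝ) ≠ 0 := by positivity
    cases k with
    | zero =>
      rw [segmentPrimitive_zero_eq ha hr.1 hra]
      simp
    | succ k =>
      simp only [segmentPrimitive, truncPow_succ_eq_ite]
      rw [Nat.factorial_succ (k + 1)]
      push_cast at hk ⊢
      field_simp

/-! ### Volume of the projected section -/

/-- The part of the unit cube in `Fin m → ℝ` over which the hyperplane `w · x = z` runs inside the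
unit cube of one more dimension, parametrized by all coordinates but the first. -/
def slab {m : ℕ} (w : Fin (m + 1) → ℝ) (z : ℝ) : Set (Fin m → ℝ) :=
  {y | (z - Fin.tail w ⬝ᵥ y) / w 0 ∈ Set.Icc (0 : ℝ) 1}

theorem measurableSet_slab {m : ℕ} (w : Fin (m + 1) → ℝ) (z : ℝ) : MeasurableSet (slab w z) :=
  measurableSet_Icc.preimage (by fun_prop)

theorem cubeMeasure_real_slab {m : ℕ} (hm : m ≠ 0) {w : Fin (m + 1) → ℝ} (hw : ∀ i, w i ≠ 0)
    (z : ℝ) :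
    (cubeMeasure m).real (slab w z) = |w 0| / (m.factorial * ∏ i, w i) *
      ∑ K : Finset (Fin (m + 1)), (-1 : ℝ) ^ K.card * truncPow (z - w ⬝ᵥ charVec K) m := by
  have h := (isPrimitiveSeq_segmentPrimitive (hw 0)).integral_cube 0
    (w := Fin.tail w) (fun i => hw i.succ) z
  have hind : (fun y => segmentPrimitive (w 0) 0 (z - Fin.tail w ⬝ᵥ y)) =
      (slab w z).indicator 1 := rfl
  rw [hind, integral_indicator_one (measurableSet_slab w z)] at h
  -- Only from index 1 on is `segmentPrimitive` a difference of truncated powers; this is where n ≥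
  -- 2 is needed.
  obtain ⟨m, rfl⟩ := Nat.exists_eq_succ_of_ne_zero hm
  rw [h, sum_finset_fin_succ fun K => (-1 : ℝ) ^ K.card * truncPow (z - w ⬝ᵥ charVec K) (m + 1),
    Finset.mul_sum, Finset.mul_sum]
  refine Finset.sum_congr rfl fun K _ => ?_
  rw [Finset.card_insert_of_notMem (by simp), Finset.card_map,
    charVec_map, charVec_insert_zero_map, dotProduct_fin_succ w (Fin.cons 0 _),
    dotProduct_fin_succ w (Fin.cons 1 _), Fin.prod_univ_succ w, zero_add]
  simp only [segmentPrimitive, Fin.cons_zero, Fin.tail_cons, mul_zero, mul_one, zero_add, pow_succ,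
    Nat.succ_eq_add_one, ← sub_sub, sub_right_comm z (w 0)]
  simp only [Fin.tail, div_eq_mul_inv, mul_inv]
  ring

/-! ### Area factor of the graph -/

/-- The linear part of the parametrization of the hyperplane `w · x = z` by all coordinates but
the first. -/
noncomputable def graphMap {m : ℕ} (c : Fin m → ℝ) :
    EuclideanSpace ℝ (Fin m) →ₗ[ℝ] EuclideanSpace ℝ (Fin (m + 1)) where
  toFun y := WithLp.toLp 2 (Fin.cons (c ⬝ᵥ y.ofLp) y.ofLp)
  map_add' x y := by
    ext i
    refine Fin.cases ?_ (fun j => ?_) i <;> simp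
  map_smul' a y := by
    ext i
    refine Fin.cases ?_ (fun j => ?_) i <;> simp

/-- The Gram matrix is the identity plus the rank-one matrix c cᵀ, so the matrix determinant lemma
applies. -/
theorem normDet_graphMap_sq {m : ℕ} (c : Fin m → ℝ) :
    (graphMap c).normDet ^ 2 = 1 + c ⬝ᵥ c := by
  have h := (graphMap c).normDet_sq_eq_det_gram (EuclideanSpace.basisFun (Fin m) ℝ)
  have hg : Matrix.gram ℝ (fun i => graphMap c (EuclideanSpace.basisFun (Fin m) ℝ i)) =
      1 + Matrix.replicateCol Unit c * Matrix.replicateRow Unit c := by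
    ext i j
    simp [graphMap, Matrix.gram_apply, PiLp.inner_apply, Fin.sum_univ_succ, Matrix.mul_apply,
      Matrix.one_apply, Pi.single_apply]
    grind
  rw [hg, Matrix.det_one_add_replicateCol_mul_replicateRow] at h
  exact_mod_cast h

theorem normDet_graphMap {m : ℕ} (w : EuclideanSpace ℝ (Fin (m + 1))) (hw : w 0 ≠ 0) :
    (graphMap fun i => -w i.succ / w 0).normDet = ‖w‖ / |w 0| := by
  rw [← sq_eq_sq₀ (LinearMap.normDet_nonneg _) (by positivity), normDet_graphMap_sq, div_pow,
    sq_abs, EuclideanSpace.norm_sq_eq, Fin.sum_univ_succ]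
  simp only [dotProduct, Real.norm_eq_abs, sq_abs]
  rw [add_div, div_self (pow_ne_zero 2 hw), Finset.sum_div]
  congr 1
  refine Finset.sum_congr rfl fun i _ => ?_
  field_simp

/-- Translating by the point (z / w₀, 0, …, 0) of the hyperplane turns the affine graph into the
image of a linear map, to which `normDet` applies. -/
theorem section_eq_preimage {m : ℕ} (w : EuclideanSpace ℝ (Fin (m + 1))) (hw : w 0 ≠ 0) (z : ℝ) :
    (fun x => WithLp.toLp 2 (Fin.cons (z / w 0) 0) + x) ⁻¹' (hyperplane w z ∩ unitCube (m + 1)) =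
      (graphMap fun i => -w i.succ / w 0) ''
        (WithLp.ofLp ⁻¹' (slab w.ofLp z ∩ Set.univ.pi fun _ => Set.Icc (0 : ℝ) 1)) := by
  have hdot : ∀ y : Fin m → ℝ, (fun i => -w i.succ / w 0) ⬝ᵥ y =
      -(Fin.tail w.ofLp ⬝ᵥ y) / w 0 := by
    intro y
    simp only [dotProduct, Fin.tail, ← Finset.sum_neg_distrib, Finset.sum_div]
    refine Finset.sum_congr rfl fun i _ => ?_
    ring
  ext x
  simp only [Set.mem_preimage, Set.mem_inter_iff, hyperplane, unitCube, Set.mem_ofPred_eq,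
    Set.mem_image, slab, Set.mem_univ_pi, dotProduct_fin_succ, Fin.forall_fin_succ]
  simp only [PiLp.add_apply, Fin.cons_zero, Fin.cons_succ, Pi.zero_apply, zero_add]
  have ht : Fin.tail (WithLp.toLp 2 (Fin.cons (z / w 0) 0 : Fin (m + 1) → ℝ) + x).ofLp =
      Fin.tail x.ofLp := by
    ext i
    simp [Fin.tail]
  rw [ht]
  constructor
  · rintro ⟨h, h0, h1⟩
    have hx0 : x 0 = -(Fin.tail w.ofLp ⬝ᵥ Fin.tail x.ofLp) / w 0 := by
      field_simp at h ⊢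
      linarith
    refine ⟨WithLp.toLp 2 (Fin.tail x.ofLp), ⟨?_, fun i => h1 i⟩, ?_⟩
    · rwa [hx0, ← add_div, ← sub_eq_add_neg] at h0
    · ext i
      refine Fin.cases ?_ (fun j => ?_) i
      · simp only [graphMap, LinearMap.coe_mk, AddHom.coe_mk, Fin.cons_zero, hdot, hx0]
      · simp [graphMap, Fin.tail]
  · rintro ⟨y, ⟨h0, h1⟩, rfl⟩
    have hy0 : (graphMap (fun i => -w i.succ / w 0) y) 0 =
        -(Fin.tail w.ofLp ⬝ᵥ y.ofLp) / w 0 := by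
      simp only [graphMap, LinearMap.coe_mk, AddHom.coe_mk, Fin.cons_zero, hdot]
    have hyt : Fin.tail (graphMap (fun i => -w i.succ / w 0) y).ofLp = y.ofLp := by
      simp [graphMap]
    rw [hyt, hy0, ← add_div, ← sub_eq_add_neg]
    refine ⟨?_, h0, fun i => ?_⟩
    · field_simp
      ring
    · simpa [graphMap] using h1 i

theorem euclideanHausdorffMeasure_section {m : ℕ} (w : EuclideanSpace ℝ (Fin (m + 1)))
    (hw : w 0 ≠ 0) (z : ℝ) :
    μHE[m] (hyperplane w z ∩ unitCube (m + 1)) =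
      ENNReal.ofReal (‖w‖ / |w 0|) * cubeMeasure m (slab w.ofLp z) := by
  rw [← measure_preimage_add _ (WithLp.toLp 2 (Fin.cons (z / w 0) 0)), section_eq_preimage w hw]
  have h := (graphMap fun i => -w i.succ / w 0).euclideanHausdorffMeasure_image_eq_normDet_mul_volume
    (WithLp.ofLp ⁻¹' (slab w.ofLp z ∩ Set.univ.pi fun _ => Set.Icc (0 : ℝ) 1))
  rw [finrank_euclideanSpace_fin] at h
  rw [h, normDet_graphMap w hw, cubeMeasure, ← Measure.restrict_pi_pi,
    Measure.restrict_apply (measurableSet_slab _ _),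
    (PiLp.volume_preserving_ofLp _).measure_preimage
      ((measurableSet_slab _ _).inter
        (MeasurableSet.univ_pi fun _ => measurableSet_Icc)).nullMeasurableSet]
  rfl

/-! ### The centered cube and sign vectors -/

theorem centered_section_eq_preimage {n : ℕ} (w : EuclideanSpace ℝ (Fin n)) :
    hyperplane w 0 ∩ centeredCube n =
      (fun x => WithLp.toLp 2 (fun _ => (1 / 2 : ℝ)) + x) ⁻¹'
        (hyperplane w ((∑ i, w i) / 2) ∩ unitCube n) := by
  ext x
  simp only [hyperplane, centeredCube, unitCube, Set.mem_preimage, Set.mem_inter_iff,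
    Set.mem_ofPred_eq, Set.mem_Icc, PiLp.add_apply, WithLp.ofLp_add, dotProduct_add]
  have h : w.ofLp ⬝ᵥ (fun _ => (1 / 2 : ℝ)) = (∑ i, w i) / 2 := by
    simp [dotProduct, ← Finset.sum_mul, div_eq_mul_inv]
  rw [h]
  refine and_congr (by simp) (forall_congr' fun i => ?_)
  constructor <;> rintro ⟨h1, h2⟩ <;> constructor <;> linarith

theorem sum_signVectors {n : ℕ} (f : (Fin n → ℝ) → ℝ) :
    ∑ s ∈ signVectors n, f s = ∑ K : Finset (Fin n), f (fun i => if i ∈ K then -1 else 1) := by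
  symm
  refine Finset.sum_bij' (fun K _ i => if i ∈ K then -1 else 1)
    (fun s _ => Finset.univ.filter fun i => s i = -1) ?_ ?_ ?_ ?_ ?_
  · intro K _
    simp only [signVectors, Fintype.mem_piFinset]
    intro i
    split_ifs <;> simp
  · simp
  · intro K _
    ext i
    by_cases hi : i ∈ K <;> simp [hi]
    norm_num
  · intro s hs
    simp only [signVectors, Fintype.mem_piFinset, Finset.mem_insert, Finset.mem_singleton] at hs
    ext i
    rcases hs i with h | h <;> simp [h]
    norm_num
  · simp

theorem truncPow_div_two (r : ℝ) (k : ℕ) : truncPow (r / 2) k = truncPow r k / 2 ^ k := by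
  rw [truncPow, truncPow, ← div_pow, ← max_div_div_right (zero_le_two (α := ℝ)), zero_div]

/-- If s is -1 on K and 1 elsewhere, then s/2 = (1/2, …, 1/2) - 1_K and ∏ sᵢ = (-1)^|K|; homogeneity
of the truncated power yields the factor 2⁻ᵏ. -/
theorem sum_charVec_eq_sum_signVectors {n : ℕ} (w : Fin n → ℝ) (k : ℕ) :
    ∑ K : Finset (Fin n), (-1 : ℝ) ^ K.card * truncPow ((∑ i, w i) / 2 - w ⬝ᵥ charVec K) k =
      (∑ s ∈ signVectors n, (∏ i, s i) * truncPow (w ⬝ᵥ s) k) / 2 ^ k := by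
  rw [sum_signVectors, Finset.sum_div _ _ ((2 : ℝ) ^ k)]
  refine Finset.sum_congr rfl fun K _ => ?_
  have h : (∑ i, w i) / 2 - w ⬝ᵥ charVec K = (w ⬝ᵥ fun i => if i ∈ K then -1 else 1) / 2 := by
    simp only [dotProduct, charVec, Finset.sum_div, ← Finset.sum_sub_distrib]
    refine Finset.sum_congr rfl fun i _ => ?_
    split_ifs <;> ring
  rw [h, truncPow_div_two, Finset.prod_ite]
  simp [mul_div_assoc]

end CubeSection

open CubeSection in
/-- `μHE[n - 1]` is the `(n-1)`-dimensional Euclidean volume: Hausdorff measure, normalized so that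
it agrees with Lebesgue measure on `(n-1)`-dimensional Euclidean space.  The norm `‖w‖` is the
`ℓ₂` norm. -/
theorem mainTheorem3 (n : ℕ) (hn : 2 ≤ n) (w : EuclideanSpace ℝ (Fin n)) (hw : ∀ i, w i ≠ 0) :
    (∀ z : ℝ,
      μHE[n - 1] (CubeSection.hyperplane w z ∩ CubeSection.unitCube n) < ⊤ ∧
      (μHE[n - 1] (CubeSection.hyperplane w z ∩ CubeSection.unitCube n)).toReal =
        ‖w‖ / ((n - 1).factorial * ∏ i, w i) *
          ∑ K : Finset (Fin n), (-1 : ℝ) ^ K.card *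
            CubeSection.truncPow (z - w.ofLp ⬝ᵥ CubeSection.charVec K) (n - 1)) ∧
    (μHE[n - 1] (CubeSection.hyperplane w 0 ∩ CubeSection.centeredCube n) < ⊤ ∧
      (μHE[n - 1] (CubeSection.hyperplane w 0 ∩ CubeSection.centeredCube n)).toReal =
        ‖w‖ / (2 ^ (n - 1) * (n - 1).factorial * ∏ i, w i) *
          ∑ s ∈ CubeSection.signVectors n, (∏ i, s i) *
            CubeSection.truncPow (w.ofLp ⬝ᵥ s) (n - 1)) := by
  obtain ⟨m, rfl⟩ : ∃ m, n = m + 1 := ⟨n - 1, by omega⟩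
  rw [Nat.add_sub_cancel]
  have hcube : ∀ z : ℝ,
      μHE[m] (hyperplane w z ∩ unitCube (m + 1)) < ⊤ ∧
      (μHE[m] (hyperplane w z ∩ unitCube (m + 1))).toReal =
        ‖w‖ / (m.factorial * ∏ i, w i) *
          ∑ K : Finset (Fin (m + 1)), (-1 : ℝ) ^ K.card *
            truncPow (z - w.ofLp ⬝ᵥ charVec K) m := by
    intro z
    rw [euclideanHausdorffMeasure_section w (hw 0)]
    refine ⟨ENNReal.mul_lt_top ENNReal.ofReal_lt_top (measure_lt_top _ _), ?_⟩
    rw [ENNReal.toReal_mul, ENNReal.toReal_ofReal (by positivity), ← Measure.real,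
      cubeMeasure_real_slab (by omega) hw, ← mul_assoc, div_mul_div_cancel₀ (abs_ne_zero.mpr (hw 0))]
  refine ⟨hcube, ?_⟩
  rw [centered_section_eq_preimage, measure_preimage_add]
  refine ⟨(hcube _).1, ?_⟩
  rw [(hcube _).2, sum_charVec_eq_sum_signVectors, mul_assoc (2 ^ m : ℝ), ← div_div]
  ring
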